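/- Let $n\ge 1$, let $\mathbb D$ be the open unit disc and $\mathbb T$ the unit circle in $\mathbb C$, and let $m_n$ be the normalized Haar measure on $\mathbb T^n$. Let $\alpha=(\alpha_1,\dots,\alpha_n)$ and $\beta=(\beta_1,\dots,\beta_n)$ in $\mathbb C^n$ satisfy $\operatorname{Re}\alpha_j+\operatorname{Re}\beta_j>-1$ and $\alpha_j,\beta_j\notin\{-1,-2,\dots\}$ for all $1\le j\le n$. For $z\in\mathbb D^n$ and $\zeta\in\mathbb T^n$ put $$P_{\alpha,\beta}(z,\zeta)=\prod_{j=1}^n \frac{\Gamma(\alpha_j+1)\Gamma(\beta_j+1)}{\Gamma(\alpha_j+\beta_j+1)}\,\frac{(1-|z_j|^2)^{\alpha_j+\beta_j+1}}{(1-z_j\overline{\zeta_j})^{\alpha_j+1}(1-\overline{z_j}\zeta_j)^{\beta_j+1}}$$ with principal branches of the powers. Let $\mu$ be a complex Borel measure on $\mathbb T^n$ and let $$u(z)=P_{\alpha,\beta}[d\mu](z)=\int_{\mathbb T^n}P_{\alpha,\beta}(z,\zeta)\,d\mu(\zeta),\qquad z\in\mathbb D^n.$$ For $\mathbf r=(r_1,\dots,r_n)\in[0,1)^n$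 let $u_{\mathbf r}(\zeta)=u(r_1\zeta_1,\dots,r_n\zeta_n)$, $\zeta\in\mathbb T^n$. Then $u_{\mathbf r}\in L^1(\mathbb T^n,m_n)$ for every $\mathbf r\in[0,1)^n$, and the complex measures $u_{\mathbf r}\,dm_n$ converge weak-$*$ to $\mu$ as $\mathbf r\to\mathbf 1=(1,\dots,1)$ in $[0,1)^n$; that is, for every continuous $\varphi:\mathbb T^n\to\mathbb C$, $$\lim_{\mathbf r\to\mathbf 1,\ \mathbf r\in[0,1)^n}\int_{\mathbb T^n}\varphi\,u_{\mathbf r}\,dm_n=\int_{\mathbb T^n}\varphi\,d\mu .$$ -/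

import Mathlib

open MeasureTheory Filter Topology

noncomputable section

/-- The unit circle carries its Borel σ-algebra. -/
instance Circle.instMeasurableSpaceBorel : MeasurableSpace Circle := borel Circle

instance Circle.instBorelSpaceBorel : BorelSpace Circle := ⟨rfl⟩

namespace PolydiscPoisson

/-- The torus `𝕋ⁿ`, the product of `n` copies of the unit circle of `ℂ`, as a compact group. -/
abbrev Torus (n : ℕ) : Type := Fin n → Circle

/-- The normalized Haar measure `m_n` of the torus (total mass one). -/
def haarTorus (n : ℕ) : Measure (Torus n) :=
  Measure.haarMeasure (⊤ : TopologicalSpace.PositiveCompacts (Torus n))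

/-- The pairing `⟨φ, dμ⟩ = ∫ φ dμ` of a complex function with a complex measure. -/
def pairing {X : Type*} [MeasurableSpace X] (φ : X → ℂ) (μ : ComplexMeasure X) : ℂ :=
  VectorMeasure.integral μ φ (ContinuousLinearMap.mul ℝ ℂ)

/-- Weak-* convergence of complex measures along a filter, the measures being regarded as
functionals on the continuous complex functions. -/
def TendstoWeakStar {X ι : Type*} [TopologicalSpace X] [MeasurableSpace X]
    (ν : ι → ComplexMeasure X) (l : Filter ι) (μ : ComplexMeasure X) : Prop :=
  ∀ φ : C(X, ℂ), Tendsto (fun i => pairing φ (ν i)) l (𝓝 (pairing φ μ))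

/-- The constant `c_{a,b} = Γ(a+1) Γ(b+1) / Γ(a+b+1)`. -/
def normConst (a b : ℂ) : ℂ :=
  Complex.Gamma (a + 1) * Complex.Gamma (b + 1) / Complex.Gamma (a + b + 1)

/-- The one-variable kernel
`c_{a,b} (1-|z|²)^{a+b+1} / ((1 - z ζ̄)^{a+1} (1 - z̄ ζ)^{b+1})` for `|z| < 1`, `|ζ| = 1`; all
powers are principal branches (the bases have positive real part). -/
def kernelOne (a b z : ℂ) (ζ : Circle) : ℂ :=
  normConst a b * (((1 - ‖z‖ ^ 2 : ℝ) : ℂ) ^ (a + b + 1) /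
    ((1 - z * starRingEnd ℂ (ζ : ℂ)) ^ (a + 1) * (1 - starRingEnd ℂ z * (ζ : ℂ)) ^ (b + 1)))

/-- The `(α, β)`-Poisson kernel of the polydisc. -/
def kernel {n : ℕ} (α β : Fin n → ℂ) (z : Fin n → ℂ) (ζ : Torus n) : ℂ :=
  ∏ j, kernelOne (α j) (β j) (z j) (ζ j)

/-- The `(α, β)`-Poisson integral `P_{α,β}[dμ]`, a function of `z` in the polydisc (only the
values at points with `|z_j| < 1` for all `j` are meaningful). -/
def poissonIntegral {n : ℕ} (α β : Fin n → ℂ) (μ : ComplexMeasure (Torus n))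
    (z : Fin n → ℂ) : ℂ :=
  pairing (fun ζ => kernel α β z ζ) μ

/-- The dilate `u_𝐫(ζ) = u(r₁ ζ₁, …, rₙ ζₙ)` on the torus. -/
def dilate {n : ℕ} (u : (Fin n → ℂ) → ℂ) (r : Fin n → ℝ) (ζ : Torus n) : ℂ :=
  u (fun j => (r j : ℂ) * (ζ j : ℂ))

/-- The cube `[0,1)ⁿ`. -/
def cube (n : ℕ) : Set (Fin n → ℝ) := {r | ∀ j, 0 ≤ r j ∧ r j < 1}

end PolydiscPoisson

end

/-! For fixed `r` the kernel depends only on `ζ * η⁻¹`, so the dilate is a convolution on the group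
`Torus n`: `u_r = K_r * μ`. Fubini and translation invariance move the kernel onto the test
function: `∫ φ u_r dm = ∫ (∫ φ(ζη) K_r(ζ) dm(ζ)) dμ(η)`. It remains to see that `K_r` is an
approximate identity; the inner integral then tends boundedly to `φ(η)`, and dominated convergence
finishes (`tendsto_integral_convolution`).

`K_r` is a product of one-variable kernels, so three facts on the circle suffice
(`tendsto_integral_mul_prod`). Put `σ = Re a + Re b + 1 > 0`. Mass: by Parseval the integral of the
kernel is `normConst a b * (1-r²)^(a+b+1) * F(a+1, b+1; 1; r²)`. It need not equal one, but
`tendsto_hypergeometric` gives its limit, and the Gamma factors cancel exactly. `L¹` bound: the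
arguments of the bases are bounded, so the kernel is at most a constant times `(1-r²)^σ
|1-rw|^(-(σ+1))`. Up to a constant this is the kernel with both parameters `(σ-1)/2`, which is
positive, so the mass limit bounds its integral too. Concentration: away from `w = 1` the
denominator stays bounded below while `(1-r²)^σ` tends to zero. -/

noncomputable section

namespace PolydiscPoisson

/-! ### Binomial coefficients and the growth of `F(p, q; 1; x)` at `x = 1` -/

/-- The Taylor coefficient `(p)_k / k!` of `(1 - x)^{-p}`. -/
def binomCoeff (p : ℂ) (k : ℕ) : ℂ :=
  (∏ j ∈ Finset.range k, (p + j)) / (k.factorial : ℂ)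

lemma choose_eq_binomCoeff (p : ℂ) (k : ℕ) : Ring.choose (p + k - 1) k = binomCoeff p k := by
  rw [Ring.choose_eq_smul, Polynomial.descPochhammer_smeval_eq_ascPochhammer,
    Polynomial.ascPochhammer_smeval_eq_eval, binomCoeff,
    show p + k - 1 - k + 1 = p by ring, smul_eq_mul, div_eq_inv_mul]
  congr 1
  induction k with
  | zero => simp
  | succ k ih => rw [Finset.prod_range_succ, ← ih, ascPochhammer_succ_eval]

lemma binomCoeff_hasSum (p : ℂ) {x : ℂ} (hx : ‖x‖ < 1) :
    HasSum (fun k => binomCoeff p k * x ^ k) (1 / (1 - x) ^ p) := by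
  have h := (Complex.one_div_one_sub_cpow_hasFPowerSeriesOnBall_zero p).hasSum (y := x)
    (by simpa [← ofReal_norm] using hx)
  simpa [FormalMultilinearSeries.ofScalars_apply_eq, choose_eq_binomCoeff, mul_comm] using h

lemma binomCoeff_summable_norm (p : ℂ) {x : ℂ} (hx : ‖x‖ < 1) :
    Summable fun k => ‖binomCoeff p k * x ^ k‖ := by
  have h0 := Complex.one_div_one_sub_cpow_hasFPowerSeriesOnBall_zero p
  have h := FormalMultilinearSeries.summable_norm_apply _
    (Metric.eball_subset_eball h0.r_le
      (show x ∈ Metric.eball (0 : ℂ) 1 by simpa [← ofReal_norm] using hx))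
  simpa [FormalMultilinearSeries.ofScalars_apply_eq, choose_eq_binomCoeff, mul_comm] using h

/-- Gauss' product formula: `(p)_k / k! ∼ k^{p-1} / Γ(p)`. -/
lemma tendsto_binomCoeff_div (p : ℂ) (hp : ∀ k : ℕ, p ≠ -(k : ℂ)) :
    Tendsto (fun k : ℕ => binomCoeff p k / (k : ℂ) ^ (p - 1)) atTop (𝓝 (1 / Complex.Gamma p)) := by
  have hne : ∀ j : ℕ, p + j ≠ 0 := fun j h => hp j (eq_neg_of_add_eq_zero_left h)
  have h1 := (Complex.GammaSeq_tendsto_Gamma p).inv₀ (Complex.Gamma_ne_zero hp)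
  -- The product in `GammaSeq` runs over `j ≤ k`, that in `binomCoeff` over `j < k`; this factor
  -- removes the extra term `p + k` and changes `k^p` into `k^(p-1)`.
  have h2 : Tendsto (fun k : ℕ => (k : ℂ) / (k + p)) atTop (𝓝 1) :=
    tendsto_natCast_div_add_atTop p
  have h3 := h1.mul h2
  rw [mul_one, ← one_div] at h3
  refine h3.congr' ?_
  filter_upwards [eventually_gt_atTop 0] with k hk
  have hk' : (k : ℂ) ≠ 0 := by exact_mod_cast hk.ne'
  have hf : (k.factorial : ℂ) ≠ 0 := by exact_mod_cast k.factorial_ne_zero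
  have hprod : ∏ j ∈ Finset.range k, (p + j) ≠ 0 := Finset.prod_ne_zero_iff.2 fun j _ => hne j
  rw [Complex.GammaSeq, binomCoeff, Finset.prod_range_succ, Complex.cpow_sub _ _ hk',
    Complex.cpow_one, add_comm (k : ℂ) p]
  have := hne k
  have hc : (k : ℂ) ^ p ≠ 0 := by simp [Complex.cpow_eq_zero_iff, hk']
  field_simp

lemma binomCoeff_ofReal (σ : ℝ) (k : ℕ) :
    binomCoeff (σ : ℂ) k =
      (((∏ j ∈ Finset.range k, (σ + j)) / (k.factorial : ℝ) : ℝ) : ℂ) := by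
  simp [binomCoeff]

/-- Positivity of these coefficients lets the series of `(1-x)^(-σ)` serve as a majorant of norms.
-/
lemma norm_binomCoeff_ofReal {σ : ℝ} (hσ : 0 < σ) (k : ℕ) :
    ((‖binomCoeff (σ : ℂ) k‖ : ℝ) : ℂ) = binomCoeff (σ : ℂ) k := by
  rw [binomCoeff_ofReal, Complex.norm_real, Real.norm_of_nonneg]
  positivity

lemma one_sub_cpow_ofReal {x : ℝ} (hx : x < 1) (σ : ℝ) :
    (1 - (x : ℂ)) ^ (σ : ℂ) = (((1 - x) ^ σ : ℝ) : ℂ) := by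
  rw [Complex.ofReal_cpow (by linarith)]; push_cast; rfl

lemma norm_binomCoeff_hasSum {σ : ℝ} (hσ : 0 < σ) {x : ℝ} (h0 : 0 ≤ x) (h1 : x < 1) :
    HasSum (fun k => ‖binomCoeff (σ : ℂ) k‖ * x ^ k) (1 / (1 - x) ^ σ) := by
  have h := binomCoeff_hasSum (σ : ℂ) (x := x) (by simpa [abs_of_nonneg h0] using h1)
  rw [← Complex.hasSum_ofReal]
  convert h using 1
  · ext k; push_cast; rw [norm_binomCoeff_ofReal hσ]
  · rw [one_sub_cpow_ofReal h1]; push_cast; rfl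

lemma tendsto_one_sub_rpow {σ : ℝ} (hσ : 0 < σ) :
    Tendsto (fun x : ℝ => (1 - x) ^ σ) (𝓝[Set.Ico 0 1] 1) (𝓝 0) := by
  have h : Tendsto (fun x : ℝ => (1 - x) ^ σ) (𝓝 1) (𝓝 ((1 - 1) ^ σ)) :=
    ((continuous_const.sub continuous_id).rpow_const fun _ => Or.inr hσ.le).tendsto 1
  rw [sub_self, Real.zero_rpow hσ.ne'] at h
  exact h.mono_left nhdsWithin_le_nhds

/-- An Abelian theorem: coefficients that are `o(k^{σ-1})` give a power series that is
`o((1-x)^{-σ})` as `x → 1`. -/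
lemma tendsto_one_sub_rpow_mul_tsum {σ : ℝ} (hσ : 0 < σ) (g : ℕ → ℂ)
    (hg : g =o[atTop] fun k => binomCoeff (σ : ℂ) k) :
    Tendsto (fun x : ℝ => (1 - x) ^ σ * ‖∑' k, g k * (x : ℂ) ^ k‖) (𝓝[Set.Ico 0 1] 1) (𝓝 0) := by
  rw [Metric.tendsto_nhds]
  intro ε hε
  -- Terms below `N` contribute at most the constant `K`, which the factor `(1-x)^σ` kills; the tail
  -- is at most `ε/2` times the majorant, whose sum is `(1-x)^(-σ)`.
  obtain ⟨N, hN⟩ := eventually_atTop.1 (hg.def (half_pos hε))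
  set K : ℝ := ∑ k ∈ Finset.range N, ‖g k‖ with hK
  have hlim := (tendsto_one_sub_rpow hσ).mul_const K
  rw [zero_mul] at hlim
  filter_upwards [hlim.eventually_lt_const (half_pos hε), self_mem_nhdsWithin] with x hx hx01
  have h1x : 0 < 1 - x := by linarith [hx01.2]
  have hpos : 0 < (1 - x) ^ σ := Real.rpow_pos_of_pos h1x _
  have hs := (norm_binomCoeff_hasSum hσ hx01.1 hx01.2).mul_left (ε / 2)
  have hfin : HasSum (fun k => if k ∈ Finset.range N then ‖g k‖ else 0) K := by
    have := hasSum_sum_of_ne_finset_zero (f := fun k => if k ∈ Finset.range N then ‖g k‖ else 0)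
      (s := Finset.range N) (L := .unconditional ℕ) (fun b hb => by simp only [hb, if_false])
    rwa [Finset.sum_congr rfl fun k hk => if_pos hk] at this
  have hbd : ∀ k, ‖g k * (x : ℂ) ^ k‖ ≤
      (if k ∈ Finset.range N then ‖g k‖ else 0) + ε / 2 * (‖binomCoeff (σ : ℂ) k‖ * x ^ k) := by
    intro k
    have hxk : 0 ≤ x ^ k := pow_nonneg hx01.1 k
    have hn : ‖g k * (x : ℂ) ^ k‖ = ‖g k‖ * x ^ k := by
      rw [norm_mul, norm_pow, Complex.norm_real, Real.norm_of_nonneg hx01.1]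
    rw [hn]
    split_ifs with h
    · have : x ^ k ≤ 1 := pow_le_one₀ hx01.1 hx01.2.le
      have h2 : 0 ≤ ε / 2 * (‖binomCoeff (σ : ℂ) k‖ * x ^ k) := by positivity
      nlinarith [norm_nonneg (g k)]
    · rw [zero_add, ← mul_assoc]
      exact mul_le_mul_of_nonneg_right (hN k (by simpa using h)) hxk
  have hle := tsum_of_norm_bounded (hfin.add hs) hbd
  rw [Real.dist_0_eq_abs, abs_of_nonneg (by positivity)]
  calc (1 - x) ^ σ * ‖∑' k, g k * (x : ℂ) ^ k‖
      ≤ (1 - x) ^ σ * (K + ε / 2 * (1 / (1 - x) ^ σ)) := by gcongr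
    _ = (1 - x) ^ σ * K + ε / 2 := by field_simp
    _ < ε := by linarith

/-- `F(p, q; 1; x) ∼ Γ(p+q-1) / (Γ(p) Γ(q)) (1-x)^{1-p-q}` as `x → 1`. -/
lemma tendsto_hypergeometric (p q : ℂ) (hp : ∀ k : ℕ, p ≠ -(k : ℂ)) (hq : ∀ k : ℕ, q ≠ -(k : ℂ))
    (hs : 0 < (p + q - 1).re) :
    Tendsto (fun x : ℝ => ((1 - x : ℝ) : ℂ) ^ (p + q - 1) *
        ∑' k, binomCoeff p k * binomCoeff q k * (x : ℂ) ^ k) (𝓝[Set.Ico 0 1] 1)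
      (𝓝 (Complex.Gamma (p + q - 1) / (Complex.Gamma p * Complex.Gamma q))) := by
  set s := p + q - 1 with hsdef
  set σ := s.re with hσ
  set l := Complex.Gamma s / (Complex.Gamma p * Complex.Gamma q) with hl
  have hns : ∀ k : ℕ, s ≠ -(k : ℂ) := by
    intro k h
    have : s.re = -(k : ℝ) := by rw [h]; simp
    have h2 : (0 : ℝ) ≤ k := Nat.cast_nonneg k
    linarith
  have hnσ : ∀ k : ℕ, (σ : ℂ) ≠ -(k : ℂ) := by
    intro k h
    have : σ = -(k : ℝ) := by exact_mod_cast h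
    have h2 : (0 : ℝ) ≤ k := Nat.cast_nonneg k
    linarith
  have hGs := Complex.Gamma_ne_zero hns
  have hGp := Complex.Gamma_ne_zero hp
  have hGq := Complex.Gamma_ne_zero hq
  -- Subtracting `l` times the coefficients of `(1-x)^(-s)` cancels the leading term `k^(s-1)`,
  -- since `(p-1) + (q-1) = s-1`; the Abelian theorem handles the remainder `g`.
  set g : ℕ → ℂ := fun k => binomCoeff p k * binomCoeff q k - l * binomCoeff s k with hg
  have hlim : Tendsto (fun k : ℕ => g k / (k : ℂ) ^ (s - 1)) atTop (𝓝 0) := by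
    have h := ((tendsto_binomCoeff_div p hp).mul (tendsto_binomCoeff_div q hq)).sub
      ((tendsto_binomCoeff_div s hns).const_mul l)
    have h0 : 1 / Complex.Gamma p * (1 / Complex.Gamma q) - l * (1 / Complex.Gamma s) = 0 := by
      rw [hl]; field_simp; ring
    rw [h0] at h
    refine h.congr' ?_
    filter_upwards [eventually_gt_atTop 0] with k hk
    have hk' : (k : ℂ) ≠ 0 := by exact_mod_cast hk.ne'
    rw [show s - 1 = (p - 1) + (q - 1) by rw [hsdef]; ring, Complex.cpow_add _ _ hk', hg]
    have h1 : (k : ℂ) ^ (p - 1) ≠ 0 := by simp [Complex.cpow_eq_zero_iff, hk']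
    have h2 : (k : ℂ) ^ (q - 1) ≠ 0 := by simp [Complex.cpow_eq_zero_iff, hk']
    field_simp
  have hgo : g =o[atTop] fun k => binomCoeff (σ : ℂ) k := by
    have hA : g =o[atTop] fun k : ℕ => (k : ℂ) ^ (s - 1) := by
      refine (Asymptotics.isLittleO_iff_tendsto' ?_).2 hlim
      filter_upwards [eventually_gt_atTop 0] with k hk h0
      have hk' : (k : ℂ) ≠ 0 := by exact_mod_cast hk.ne'
      simp [Complex.cpow_eq_zero_iff, hk'] at h0
    -- Both powers have the same modulus; this passes from the complex exponent `s` to its real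
    -- part, as the Abelian theorem requires.
    have hB : (fun k : ℕ => (k : ℂ) ^ (s - 1)) =O[atTop] fun k : ℕ => (k : ℂ) ^ ((σ : ℂ) - 1) := by
      refine Asymptotics.IsBigO.of_bound 1 ?_
      filter_upwards [eventually_gt_atTop 0] with k hk
      rw [Complex.norm_natCast_cpow_of_pos hk, Complex.norm_natCast_cpow_of_pos hk]
      simp [hσ]
    have hC : (fun k : ℕ => (k : ℂ) ^ ((σ : ℂ) - 1)) =O[atTop] fun k => binomCoeff (σ : ℂ) k := by
      have hGσ : Complex.Gamma σ ≠ 0 := Complex.Gamma_ne_zero hnσ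
      have h := (tendsto_binomCoeff_div σ hnσ).inv₀ (by simpa using hGσ)
      have h' := h.isBigO_one ℂ
      have h2 := h'.mul (Asymptotics.isBigO_refl (fun k => binomCoeff (σ : ℂ) k) atTop)
      refine (h2.congr' ?_ ?_)
      · filter_upwards with k
        have : binomCoeff (σ : ℂ) k ≠ 0 := by
          rw [binomCoeff]
          refine div_ne_zero (Finset.prod_ne_zero_iff.2 fun j _ h => hnσ j
            (eq_neg_of_add_eq_zero_left h)) (by exact_mod_cast k.factorial_ne_zero)
        rw [inv_div, div_mul_cancel₀ _ this]
      · filter_upwards with k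
        rw [one_mul]
    exact (hA.trans_isBigO hB).trans_isBigO hC
  have habel := tendsto_one_sub_rpow_mul_tsum hs g hgo
  have hz : Tendsto (fun x : ℝ => ((1 - x : ℝ) : ℂ) ^ s * ∑' k, g k * (x : ℂ) ^ k)
      (𝓝[Set.Ico 0 1] 1) (𝓝 0) := by
    rw [tendsto_zero_iff_norm_tendsto_zero]
    refine habel.congr' ?_
    filter_upwards [self_mem_nhdsWithin] with x hx
    rw [norm_mul, Complex.norm_cpow_eq_rpow_re_of_pos (by linarith [hx.2])]
  have hfinal := hz.const_add l
  rw [add_zero] at hfinal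
  refine hfinal.congr' ?_
  filter_upwards [self_mem_nhdsWithin] with x hx
  have hxn : ‖(x : ℂ)‖ < 1 := by simpa [abs_of_nonneg hx.1] using hx.2
  have hS := binomCoeff_hasSum s hxn
  have hne : (1 - (x : ℂ)) ^ s ≠ 0 := by
    have : (1 - (x : ℂ)) ≠ 0 := by
      intro h
      have : (1 - x : ℝ) = 0 := by exact_mod_cast h
      linarith [hx.2]
    simp [Complex.cpow_eq_zero_iff, this]
  have hpq : Summable fun k => binomCoeff p k * binomCoeff q k * (x : ℂ) ^ k := by
    -- With `x = √x * √x`, the series is the diagonal of a product of two absolutely convergent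
    -- series at `√x`.
    have hrn : ‖((√x : ℝ) : ℂ)‖ < 1 := by
      rw [Complex.norm_real, Real.norm_of_nonneg (Real.sqrt_nonneg _)]
      rw [Real.sqrt_lt' one_pos]; simpa using hx.2
    have h1 := binomCoeff_summable_norm p hrn
    have h2 := binomCoeff_summable_norm q hrn
    have h3 := (summable_mul_of_summable_norm h1 h2).comp_injective
      (i := fun k : ℕ => (k, k)) (fun a b h => (Prod.ext_iff.1 h).1)
    refine h3.congr fun k => ?_
    simp only [Function.comp]
    have : (x : ℂ) = ((√x : ℝ) : ℂ) * ((√x : ℝ) : ℂ) := by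
      rw [← Complex.ofReal_mul, Real.mul_self_sqrt hx.1]
    rw [this, mul_pow]; ring
  have hsub : ∑' k, g k * (x : ℂ) ^ k =
      ∑' k, binomCoeff p k * binomCoeff q k * (x : ℂ) ^ k - l * (1 / (1 - (x : ℂ)) ^ s) := by
    rw [← (hpq.hasSum.sub (hS.mul_left l)).tsum_eq]
    refine tsum_congr fun k => ?_
    rw [hg]; ring
  rw [hsub]
  push_cast
  field_simp
  ring

/-! ### Complex measures as densities -/

section ComplexMeasures

variable {X : Type*} [MeasurableSpace X]

/-- Every complex measure has an integrable density with respect to a finite positive measure. -/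
lemma exists_withDensityᵥ_eq (μ : ComplexMeasure X) :
    ∃ (ν : Measure X) (f : X → ℂ), IsFiniteMeasure ν ∧ Integrable f ν ∧ μ = ν.withDensityᵥ f := by
  set s := ComplexMeasure.re μ
  set t := ComplexMeasure.im μ
  -- This measure dominates both the real and the imaginary part, so Radon–Nikodym applies to each.
  set ν := s.totalVariation + t.totalVariation with hν
  have hfin : IsFiniteMeasure ν := by
    rw [hν, SignedMeasure.totalVariation, SignedMeasure.totalVariation]; infer_instance
  have hac : ∀ w : SignedMeasure X, w.totalVariation ≤ ν → ν.withDensityᵥ (w.rnDeriv ν) = w := by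
    intro w hw
    refine w.withDensityᵥ_rnDeriv_eq ν ?_
    rw [SignedMeasure.absolutelyContinuous_ennreal_iff,
      VectorMeasure.ennrealToMeasure_toENNRealVectorMeasure]
    exact Measure.absolutelyContinuous_of_le hw
  have hs := hac s (Measure.le_add_right le_rfl)
  have ht := hac t (Measure.le_add_left le_rfl)
  have hsi : Integrable (s.rnDeriv ν) ν := SignedMeasure.integrable_rnDeriv _ _
  have hti : Integrable (t.rnDeriv ν) ν := SignedMeasure.integrable_rnDeriv _ _
  have hfi : Integrable (fun x => (s.rnDeriv ν x : ℂ) + t.rnDeriv ν x * Complex.I) ν :=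
    hsi.ofReal.add (hti.ofReal.mul_const _)
  refine ⟨ν, _, hfin, hfi, ?_⟩
  ext1 i hi
  have h1 : s i = ∫ x in i, s.rnDeriv ν x ∂ν := by
    rw [← withDensityᵥ_apply hsi hi, hs]
  have h2 : t i = ∫ x in i, t.rnDeriv ν x ∂ν := by
    rw [← withDensityᵥ_apply hti hi, ht]
  have hadd : ∫ x in i, ((s.rnDeriv ν x : ℂ) + t.rnDeriv ν x * Complex.I) ∂ν =
      ∫ x in i, (s.rnDeriv ν x : ℂ) ∂ν + ∫ x in i, (t.rnDeriv ν x : ℂ) * Complex.I ∂ν :=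
    integral_add hsi.ofReal.restrict (hti.ofReal.mul_const _).restrict
  rw [withDensityᵥ_apply hfi hi, hadd, integral_mul_const, integral_complex_ofReal,
    integral_complex_ofReal,
    ← h1, ← h2]
  exact (Complex.re_add_im (μ i)).symm

lemma pairing_withDensityᵥ_indicator {ν : Measure X} {f : X → ℂ} (hf : Integrable f ν) (c : ℂ)
    {A : Set X} (hA : MeasurableSet A) :
    pairing (A.indicator fun _ => c) (ν.withDensityᵥ f) = ∫ x, A.indicator (fun _ => c) x * f x ∂ν := by
  have hfin : IsFiniteMeasure (ν.withDensityᵥ f).variation := by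
    rw [Measure.variation_withDensityᵥ hf]
    exact isFiniteMeasure_withDensity hf.2.ne
  rw [pairing, VectorMeasure.integral_indicator hA, VectorMeasure.integral_const,
    VectorMeasure.restrict_apply _ hA .univ, Set.univ_inter, withDensityᵥ_apply hf hA,
    ContinuousLinearMap.mul_apply', ← integral_const_mul, ← integral_indicator hA]
  refine integral_congr_ae (.of_forall fun x => ?_)
  by_cases hx : x ∈ A <;> simp [hx]

/-- Integration against a complex measure with density `f`. -/
lemma pairing_withDensityᵥ {ν : Measure X} {f : X → ℂ} (hf : Integrable f ν) {φ : X → ℂ}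
    (hφ : StronglyMeasurable φ) {C : ℝ} (hC : ∀ x, ‖φ x‖ ≤ C) :
    pairing φ (ν.withDensityᵥ f) = ∫ x, φ x * f x ∂ν := by
  have hfin : IsFiniteMeasure (ν.withDensityᵥ f).variation := by
    rw [Measure.variation_withDensityᵥ hf]
    exact isFiniteMeasure_withDensity hf.2.ne
  have hsimple : ∀ g : SimpleFunc X ℂ,
      pairing g (ν.withDensityᵥ f) = ∫ x, g x * f x ∂ν := by
    intro g
    induction g using SimpleFunc.induction with
    | @const c A hA =>
      have hcoe : ⇑(SimpleFunc.piecewise A hA (SimpleFunc.const X c) (SimpleFunc.const X 0)) =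
          A.indicator fun _ => c := by
        classical
        rw [SimpleFunc.coe_piecewise, SimpleFunc.coe_const, SimpleFunc.coe_const,
          Function.const_zero, Set.piecewise_eq_indicator]
        rfl
      rw [hcoe]
      exact pairing_withDensityᵥ_indicator hf c hA
    | @add g h _ hg hh =>
      have hint : ∀ g : SimpleFunc X ℂ, Integrable (fun x => g x * f x) ν := fun g => by
        obtain ⟨K, hK⟩ := g.exists_forall_norm_le
        exact hf.bdd_mul g.stronglyMeasurable.aestronglyMeasurable (.of_forall hK)
      have hadd : pairing (⇑(g + h)) (ν.withDensityᵥ f) =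
          pairing g (ν.withDensityᵥ f) + pairing h (ν.withDensityᵥ f) := by
        rw [SimpleFunc.coe_add]
        exact VectorMeasure.integral_add (g.integrable_of_isFiniteMeasure)
          (h.integrable_of_isFiniteMeasure)
      rw [hadd, hg, hh, ← integral_add (hint g) (hint h)]
      simp [add_mul]
  have hC0 : ∀ x, 0 ≤ C := fun x => (norm_nonneg _).trans (hC x)
  -- On an empty space `C` may be negative, whereas the bounded approximation below needs `0 ≤ C`.
  rcases isEmpty_or_nonempty X with hX | ⟨⟨x₀⟩⟩
  · have h0 : φ = (0 : SimpleFunc X ℂ) := funext fun x => isEmptyElim x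
    rw [h0]; exact hsimple 0
  have hbd : ∀ n x, ‖hφ.approxBounded C n x‖ ≤ C := fun n x =>
    hφ.norm_approxBounded_le (hC0 x₀) n x
  have hlim : ∀ x, Tendsto (fun n => hφ.approxBounded C n x) atTop (𝓝 (φ x)) := fun x =>
    hφ.tendsto_approxBounded_of_norm_le (hC x)
  have h1 : Tendsto (fun n => pairing (hφ.approxBounded C n) (ν.withDensityᵥ f)) atTop
      (𝓝 (pairing φ (ν.withDensityᵥ f))) :=
    VectorMeasure.tendsto_integral_filter_of_norm_le_const
      (.of_forall fun n => (hφ.approxBounded C n).stronglyMeasurable.aestronglyMeasurable)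
      ⟨C, .of_forall fun n => .of_forall (hbd n)⟩ (.of_forall hlim)
  have h2 : Tendsto (fun n => ∫ x, hφ.approxBounded C n x * f x ∂ν) atTop
      (𝓝 (∫ x, φ x * f x ∂ν)) := by
    refine tendsto_integral_of_dominated_convergence (fun x => C * ‖f x‖)
      (fun n => (hφ.approxBounded C n).stronglyMeasurable.aestronglyMeasurable.mul hf.1)
      (hf.norm.const_mul C) (fun n => .of_forall fun x => ?_)
      (.of_forall fun x => (hlim x).mul_const _)
    rw [norm_mul]
    exact mul_le_mul_of_nonneg_right (hbd n x) (norm_nonneg _)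
  exact tendsto_nhds_unique (h1.congr fun n => hsimple _) h2

end ComplexMeasures

/-! ### Haar measure and Parseval's formula on the circle -/

/-- The normalized Haar measure of the circle. -/
def haarCircle : Measure Circle :=
  Measure.haarMeasure (⊤ : TopologicalSpace.PositiveCompacts Circle)

instance : haarCircle.IsHaarMeasure := by unfold haarCircle; infer_instance

instance : IsProbabilityMeasure haarCircle :=
  ⟨by simpa [haarCircle] using
    Measure.haarMeasure_self (K₀ := (⊤ : TopologicalSpace.PositiveCompacts Circle))⟩

/-- Rotation by `exp(iπ/m)` preserves the measure and changes the sign of `w^m`, so the integral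
equals its own negative. -/
lemma integral_zpow_haarCircle {m : ℤ} (hm : m ≠ 0) :
    ∫ w : Circle, (w : ℂ) ^ m ∂haarCircle = 0 := by
  set c : Circle := Circle.exp (Real.pi / m) with hc
  have hcm : (c : ℂ) ^ m = -1 := by
    have hm' : (m : ℂ) ≠ 0 := by exact_mod_cast hm
    rw [hc, Circle.coe_exp, ← Complex.exp_int_mul]
    push_cast
    rw [show (m : ℂ) * (Real.pi / m * Complex.I) = Real.pi * Complex.I by field_simp,
      Complex.exp_pi_mul_I]
  have h := integral_mul_left_eq_self (μ := haarCircle) (fun w : Circle => (w : ℂ) ^ m) c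
  simp only [Circle.coe_mul, mul_zpow, hcm, neg_mul, one_mul, integral_neg] at h
  linear_combination (-1 / 2 : ℂ) * h

lemma integral_pow_mul_conj_pow (i j : ℕ) :
    ∫ w : Circle, (w : ℂ) ^ i * (starRingEnd ℂ (w : ℂ)) ^ j ∂haarCircle =
      if i = j then 1 else 0 := by
  have h : ∀ w : Circle, (w : ℂ) ^ i * (starRingEnd ℂ (w : ℂ)) ^ j = (w : ℂ) ^ ((i : ℤ) - j) := by
    intro w
    rw [← Circle.coe_inv_eq_conj, Circle.coe_inv, zpow_sub₀ w.coe_ne_zero, zpow_natCast,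
      zpow_natCast, inv_pow, div_eq_mul_inv]
  simp only [h]
  split_ifs with hij
  · simp [hij]
  · exact integral_zpow_haarCircle (by omega)

lemma continuous_circle_coe : Continuous fun w : Circle => (w : ℂ) := continuous_subtype_val

lemma continuous_circle_conj : Continuous fun w : Circle => starRingEnd ℂ (w : ℂ) :=
  Complex.continuous_conj.comp continuous_circle_coe

lemma integrable_circle_of_continuous {f : Circle → ℂ} (hf : Continuous f) :
    Integrable f haarCircle :=
  hf.integrable_of_hasCompactSupport (HasCompactSupport.of_compactSpace _)

lemma tsum_diagonal (a b : ℕ → ℂ) :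
    ∑' ij : ℕ × ℕ, (if ij.1 = ij.2 then a ij.1 * b ij.2 else 0) = ∑' k, a k * b k := by
  rw [← (Function.Injective.tsum_eq (g := fun k : ℕ => (k, k))
    (fun x y h => (Prod.ext_iff.1 h).1) ?_)]
  · simp
  · rintro ⟨i, j⟩ h
    by_cases hij : i = j
    · exact ⟨i, by simp [hij]⟩
    · simp [hij] at h

/-- Parseval's formula for absolutely convergent power series on the circle. -/
lemma integral_mul_conj_tsum {a b : ℕ → ℂ} (ha : Summable fun k => ‖a k‖)
    (hb : Summable fun k => ‖b k‖) :
    ∫ w : Circle, (∑' k, a k * (w : ℂ) ^ k) * (∑' k, b k * (starRingEnd ℂ (w : ℂ)) ^ k) ∂haarCircle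
      = ∑' k, a k * b k := by
  have hint : ∀ ij : ℕ × ℕ, Integrable (fun w : Circle =>
      (a ij.1 * (w : ℂ) ^ ij.1) * (b ij.2 * (starRingEnd ℂ (w : ℂ)) ^ ij.2)) haarCircle :=
    fun ij => integrable_circle_of_continuous
      ((continuous_const.mul (continuous_circle_coe.pow _)).mul
        (continuous_const.mul (continuous_circle_conj.pow _)))
  have hnorm : ∀ (ij : ℕ × ℕ) (w : Circle),
      ‖(a ij.1 * (w : ℂ) ^ ij.1) * (b ij.2 * (starRingEnd ℂ (w : ℂ)) ^ ij.2)‖ =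
        ‖a ij.1‖ * ‖b ij.2‖ := fun ij w => by
    simp only [norm_mul, norm_pow, Complex.norm_conj, Circle.norm_coe, one_pow, mul_one]
  have hprod : Summable fun ij : ℕ × ℕ => ‖a ij.1‖ * ‖b ij.2‖ :=
    ha.mul_of_nonneg hb (fun _ => norm_nonneg _) fun _ => norm_nonneg _
  have hsum := hasSum_integral_of_summable_integral_norm hint (by
    simpa only [hnorm, integral_const, probReal_univ, one_smul] using hprod)
  have hval : ∀ ij : ℕ × ℕ, ∫ w : Circle,
      (a ij.1 * (w : ℂ) ^ ij.1) * (b ij.2 * (starRingEnd ℂ (w : ℂ)) ^ ij.2) ∂haarCircle =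
        if ij.1 = ij.2 then a ij.1 * b ij.2 else 0 := by
    intro ij
    simp only [mul_mul_mul_comm]
    rw [integral_const_mul, integral_pow_mul_conj_pow]
    split_ifs <;> simp
  have htsum : ∀ w : Circle, (∑' k, a k * (w : ℂ) ^ k) *
      (∑' k, b k * (starRingEnd ℂ (w : ℂ)) ^ k) = ∑' ij : ℕ × ℕ,
        (a ij.1 * (w : ℂ) ^ ij.1) * (b ij.2 * (starRingEnd ℂ (w : ℂ)) ^ ij.2) := fun w =>
    tsum_mul_tsum_of_summable_norm (f := fun k => a k * (w : ℂ) ^ k)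
      (g := fun k => b k * (starRingEnd ℂ (w : ℂ)) ^ k)
      (ha.congr fun k => by rw [norm_mul, norm_pow, Circle.norm_coe, one_pow, mul_one])
      (hb.congr fun k => by
        rw [norm_mul, norm_pow, Complex.norm_conj, Circle.norm_coe, one_pow, mul_one])
  rw [integral_congr_ae (.of_forall htsum), ← hsum.tsum_eq, tsum_congr hval, tsum_diagonal]

/-! ### The one-variable kernel and its mass -/

/-- The one-variable kernel as a convolution kernel. -/
def convKernel (a b : ℂ) (r : ℝ) (w : Circle) : ℂ :=
  normConst a b * (((1 - r ^ 2 : ℝ) : ℂ) ^ (a + b + 1) /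
    ((1 - r * (w : ℂ)) ^ (a + 1) * (1 - r * starRingEnd ℂ (w : ℂ)) ^ (b + 1)))

lemma kernelOne_eq_convKernel (a b : ℂ) (r : ℝ) (ζ η : Circle) :
    kernelOne a b (r * (ζ : ℂ)) η = convKernel a b r (ζ * η⁻¹) := by
  have h1 : ‖(r : ℂ) * (ζ : ℂ)‖ ^ 2 = r ^ 2 := by
    simp [Circle.norm_coe]
  rw [kernelOne, convKernel, h1, Circle.coe_mul, Circle.coe_inv_eq_conj]
  simp only [map_mul, Complex.conj_ofReal, Complex.conj_conj, mul_assoc]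

lemma norm_mul_circle_lt {r : ℝ} (hr : r ∈ Set.Ico (0 : ℝ) 1) (w : Circle) :
    ‖(r : ℂ) * (w : ℂ)‖ < 1 := by
  simpa [Circle.norm_coe, abs_of_nonneg hr.1] using hr.2

lemma norm_mul_conj_circle_lt {r : ℝ} (hr : r ∈ Set.Ico (0 : ℝ) 1) (w : Circle) :
    ‖(r : ℂ) * starRingEnd ℂ (w : ℂ)‖ < 1 := by
  simpa [Circle.norm_coe, abs_of_nonneg hr.1] using hr.2

lemma one_sub_mem_slitPlane {z : ℂ} (hz : ‖z‖ < 1) : 1 - z ∈ Complex.slitPlane := by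
  have := Complex.mem_slitPlane_of_norm_lt_one (z := -z) (by simpa using hz)
  rwa [← sub_eq_add_neg] at this

lemma continuous_convKernel (a b : ℂ) {r : ℝ} (hr : r ∈ Set.Ico (0 : ℝ) 1) :
    Continuous (convKernel a b r) := by
  have h1 : Continuous fun w : Circle => (w : ℂ) := continuous_subtype_val
  have h2 : Continuous fun w : Circle => starRingEnd ℂ (w : ℂ) := Complex.continuous_conj.comp h1
  have m1 := fun w => one_sub_mem_slitPlane (norm_mul_circle_lt hr w)
  have m2 := fun w => one_sub_mem_slitPlane (norm_mul_conj_circle_lt hr w)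
  unfold convKernel
  refine continuous_const.mul (continuous_const.div ?_ fun w => ?_)
  · exact ((continuous_const.sub (continuous_const.mul h1)).cpow continuous_const m1).mul
      ((continuous_const.sub (continuous_const.mul h2)).cpow continuous_const m2)
  · simp [Complex.cpow_eq_zero_iff, Complex.slitPlane_ne_zero (m1 w),
      Complex.slitPlane_ne_zero (m2 w)]

/-- Both factors of the denominator expand in power series, one in `w` and one in its conjugate;
Parseval keeps the diagonal terms, leaving `F(a+1, b+1; 1; r²)`. -/
lemma integral_convKernel (a b : ℂ) {r : ℝ} (hr : r ∈ Set.Ico (0 : ℝ) 1) :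
    ∫ w, convKernel a b r w ∂haarCircle = normConst a b * (((1 - r ^ 2 : ℝ) : ℂ) ^ (a + b + 1) *
      ∑' k, binomCoeff (a + 1) k * binomCoeff (b + 1) k * ((r ^ 2 : ℝ) : ℂ) ^ k) := by
  have hrn : ‖(r : ℂ)‖ < 1 := by simpa [Circle.norm_coe, abs_of_nonneg hr.1] using hr.2
  have hP := integral_mul_conj_tsum (binomCoeff_summable_norm (a + 1) hrn)
    (binomCoeff_summable_norm (b + 1) hrn)
  have hpt : ∀ w : Circle, convKernel a b r w =
      normConst a b * ((1 - r ^ 2 : ℝ) : ℂ) ^ (a + b + 1) *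
      ((∑' k, binomCoeff (a + 1) k * (r : ℂ) ^ k * (w : ℂ) ^ k) *
        (∑' k, binomCoeff (b + 1) k * (r : ℂ) ^ k * (starRingEnd ℂ (w : ℂ)) ^ k)) := by
    intro w
    simp only [mul_assoc, ← mul_pow]
    rw [(binomCoeff_hasSum (a + 1) (norm_mul_circle_lt hr w)).tsum_eq,
      (binomCoeff_hasSum (b + 1) (norm_mul_conj_circle_lt hr w)).tsum_eq, convKernel,
      div_eq_mul_one_div, ← one_div_mul_one_div]
  simp only [hpt]
  rw [integral_const_mul, hP, mul_assoc]
  congr 3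
  ext k
  push_cast
  ring

lemma tendsto_sq_Ico : Tendsto (fun r : ℝ => r ^ 2) (𝓝[Set.Ico 0 1] 1) (𝓝[Set.Ico 0 1] 1) := by
  refine tendsto_nhdsWithin_iff.2 ⟨?_, ?_⟩
  · have : Tendsto (fun r : ℝ => r ^ 2) (𝓝 1) (𝓝 (1 ^ 2)) := (continuous_pow 2).tendsto 1
    rw [one_pow] at this
    exact this.mono_left nhdsWithin_le_nhds
  · filter_upwards [self_mem_nhdsWithin] with r hr
    exact ⟨sq_nonneg r, by have := hr.1; have := hr.2; nlinarith⟩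

/-- The mass of the kernel tends to one. -/
lemma tendsto_integral_convKernel (a b : ℂ) (hre : -1 < a.re + b.re)
    (ha : ∀ k : ℕ, a ≠ -((k : ℂ) + 1)) (hb : ∀ k : ℕ, b ≠ -((k : ℂ) + 1)) :
    Tendsto (fun r => ∫ w, convKernel a b r w ∂haarCircle) (𝓝[Set.Ico 0 1] 1) (𝓝 1) := by
  have ha' : ∀ k : ℕ, a + 1 ≠ -(k : ℂ) := fun k h => ha k (by linear_combination h)
  have hb' : ∀ k : ℕ, b + 1 ≠ -(k : ℂ) := fun k h => hb k (by linear_combination h)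
  have hs : a + 1 + (b + 1) - 1 = a + b + 1 := by ring
  have hre' : 0 < (a + b + 1).re := by simp; linarith
  have h := tendsto_hypergeometric (a + 1) (b + 1) ha' hb' (by rw [hs]; exact hre')
  rw [hs] at h
  have h' := (h.comp tendsto_sq_Ico).const_mul (normConst a b)
  have h1 : normConst a b * (Complex.Gamma (a + b + 1) /
      (Complex.Gamma (a + 1) * Complex.Gamma (b + 1))) = 1 := by
    have := Complex.Gamma_ne_zero ha'
    have := Complex.Gamma_ne_zero hb'
    have := Complex.Gamma_ne_zero_of_re_pos hre'
    rw [normConst]; field_simp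
  rw [h1] at h'
  refine h'.congr' ?_
  filter_upwards [self_mem_nhdsWithin] with r hr
  rw [integral_convKernel a b hr]
  rfl

/-! ### `L¹` bounds and concentration of the kernel -/

lemma norm_cpow_le_const {z : ℂ} (hz : z ≠ 0) (p : ℂ) :
    1 / ‖z ^ p‖ ≤ Real.exp (Real.pi * |p.im|) * ‖z‖ ^ (-p.re) := by
  rw [Complex.norm_cpow_of_ne_zero hz, one_div_div, Real.rpow_neg (norm_nonneg _),
    div_eq_mul_inv]
  refine mul_le_mul_of_nonneg_right (Real.exp_le_exp.2 ?_) (by positivity)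
  calc z.arg * p.im ≤ |z.arg * p.im| := le_abs_self _
    _ = |z.arg| * |p.im| := abs_mul _ _
    _ ≤ Real.pi * |p.im| := by gcongr; exact Complex.abs_arg_le_pi z

lemma norm_one_sub_conj (r : ℝ) (w : Circle) :
    ‖1 - (r : ℂ) * starRingEnd ℂ (w : ℂ)‖ = ‖1 - (r : ℂ) * (w : ℂ)‖ := by
  rw [← Complex.norm_conj]; simp

/-- Size estimate for the kernel. -/
lemma exists_norm_convKernel_le (a b : ℂ) :
    ∃ C, 0 ≤ C ∧ ∀ r ∈ Set.Ico (0 : ℝ) 1, ∀ w : Circle, ‖convKernel a b r w‖ ≤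
      C * ((1 - r ^ 2) ^ (a.re + b.re + 1) * ‖1 - (r : ℂ) * (w : ℂ)‖ ^ (-(a.re + b.re + 2))) := by
  refine ⟨‖normConst a b‖ * (Real.exp (Real.pi * |(a + 1).im|) *
    Real.exp (Real.pi * |(b + 1).im|)), by positivity, fun r hr w => ?_⟩
  have n1 := Complex.slitPlane_ne_zero (one_sub_mem_slitPlane (norm_mul_circle_lt hr w))
  have n2 := Complex.slitPlane_ne_zero (one_sub_mem_slitPlane (norm_mul_conj_circle_lt hr w))
  have h1 := norm_cpow_le_const n1 (a + 1)
  have h2 := norm_cpow_le_const n2 (b + 1)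
  rw [norm_one_sub_conj] at h2
  have hr2 : 0 < 1 - r ^ 2 := by have := hr.1; have := hr.2; nlinarith
  have hpos : 0 < ‖1 - (r : ℂ) * (w : ℂ)‖ := norm_pos_iff.2 n1
  rw [convKernel, norm_mul, norm_div, norm_mul, Complex.norm_cpow_eq_rpow_re_of_pos hr2,
    div_eq_mul_one_div, ← one_div_mul_one_div]
  have hexp : ‖1 - (r : ℂ) * (w : ℂ)‖ ^ (-(a.re + b.re + 2)) =
      ‖1 - (r : ℂ) * (w : ℂ)‖ ^ (-(a + 1).re) * ‖1 - (r : ℂ) * (w : ℂ)‖ ^ (-(b + 1).re) := by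
    rw [← Real.rpow_add hpos]; congr 1; simp; ring
  have hs : (a + b + 1).re = a.re + b.re + 1 := by simp
  rw [hexp, hs]
  calc _ ≤ ‖normConst a b‖ * ((1 - r ^ 2) ^ (a.re + b.re + 1) *
        ((Real.exp (Real.pi * |(a + 1).im|) * ‖1 - (r : ℂ) * (w : ℂ)‖ ^ (-(a + 1).re)) *
        (Real.exp (Real.pi * |(b + 1).im|) * ‖1 - (r : ℂ) * (w : ℂ)‖ ^ (-(b + 1).re)))) := by
        have := Real.rpow_nonneg hr2.le (a.re + b.re + 1)
        gcongr
    _ = _ := by ring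

/-- The kernel with equal real parameters is positive. -/
lemma convKernel_diagonal (σ : ℝ) {r : ℝ} (hr : r ∈ Set.Ico (0 : ℝ) 1) (w : Circle) :
    convKernel (((σ - 1) / 2 : ℝ) : ℂ) (((σ - 1) / 2 : ℝ) : ℂ) r w =
      normConst (((σ - 1) / 2 : ℝ) : ℂ) (((σ - 1) / 2 : ℝ) : ℂ) *
      (((1 - r ^ 2) ^ σ * ‖1 - (r : ℂ) * (w : ℂ)‖ ^ (-(σ + 1)) : ℝ) : ℂ) := by
  have n1 := one_sub_mem_slitPlane (norm_mul_circle_lt hr w)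
  have hr2 : 0 < 1 - r ^ 2 := by have := hr.1; have := hr.2; nlinarith
  have hpos : 0 < ‖1 - (r : ℂ) * (w : ℂ)‖ := norm_pos_iff.2 (Complex.slitPlane_ne_zero n1)
  have hconj : 1 - (r : ℂ) * starRingEnd ℂ (w : ℂ) = starRingEnd ℂ (1 - (r : ℂ) * (w : ℂ)) := by simp
  have e1 : (((σ - 1) / 2 : ℝ) : ℂ) + (((σ - 1) / 2 : ℝ) : ℂ) + 1 = (σ : ℂ) := by push_cast; ring
  have e2 : (((σ - 1) / 2 : ℝ) : ℂ) + 1 = (((σ + 1) / 2 : ℝ) : ℂ) := by push_cast; ring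
  have hc := Complex.conj_cpow (1 - (r : ℂ) * (w : ℂ)) (((σ + 1) / 2 : ℝ) : ℂ)
    (Complex.slitPlane_arg_ne_pi n1)
  rw [Complex.conj_ofReal] at hc
  rw [convKernel, e1, e2, hconj, hc, Complex.mul_conj, ← Complex.ofReal_cpow hr2.le,
    Complex.normSq_eq_norm_sq, Complex.norm_cpow_real, ← Complex.ofReal_div,
    ← Real.rpow_mul_natCast hpos.le, Real.rpow_neg hpos.le, div_eq_mul_inv]
  congr 5
  push_cast; ring

lemma normConst_diagonal_ne_zero {σ : ℝ} (hσ : 0 < σ) :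
    normConst (((σ - 1) / 2 : ℝ) : ℂ) (((σ - 1) / 2 : ℝ) : ℂ) ≠ 0 := by
  have h1 : Complex.Gamma ((((σ - 1) / 2 : ℝ) : ℂ) + 1) ≠ 0 :=
    Complex.Gamma_ne_zero_of_re_pos (by
      rw [Complex.add_re, Complex.ofReal_re, Complex.one_re]; linarith)
  have h2 : Complex.Gamma ((((σ - 1) / 2 : ℝ) : ℂ) + (((σ - 1) / 2 : ℝ) : ℂ) + 1) ≠ 0 :=
    Complex.Gamma_ne_zero_of_re_pos (by
      rw [Complex.add_re, Complex.add_re, Complex.ofReal_re, Complex.one_re]; linarith)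
  exact div_ne_zero (mul_ne_zero h1 h1) h2

lemma one_sub_mul_circle_ne_zero {r : ℝ} (hr : r ∈ Set.Ico (0 : ℝ) 1) (w : Circle) :
    1 - (r : ℂ) * (w : ℂ) ≠ 0 :=
  Complex.slitPlane_ne_zero (one_sub_mem_slitPlane (norm_mul_circle_lt hr w))

lemma continuous_norm_rpow (τ : ℝ) {r : ℝ} (hr : r ∈ Set.Ico (0 : ℝ) 1) :
    Continuous fun w : Circle => ‖1 - (r : ℂ) * (w : ℂ)‖ ^ τ :=
  (continuous_const.sub (continuous_const.mul continuous_circle_coe)).norm.rpow_const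
    fun w => Or.inl (norm_ne_zero_iff.2 (one_sub_mul_circle_ne_zero hr w))

lemma integrable_circle_real {f : Circle → ℝ} (hf : Continuous f) : Integrable f haarCircle :=
  hf.integrable_of_hasCompactSupport (HasCompactSupport.of_compactSpace _)

/-- No direct estimate is needed: by `convKernel_diagonal` the integrand is a constant multiple of a
kernel whose mass tends to one, hence is eventually below `2`. -/
lemma exists_eventually_integral_rpow_le {σ : ℝ} (hσ : 0 < σ) :
    ∃ K : ℝ, ∀ᶠ r : ℝ in 𝓝[Set.Ico (0 : ℝ) 1] 1,
      ∫ w : Circle, (1 - r ^ 2) ^ σ * ‖1 - (r : ℂ) * (w : ℂ)‖ ^ (-(σ + 1)) ∂haarCircle ≤ K := by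
  set d : ℂ := (((σ - 1) / 2 : ℝ) : ℂ) with hd
  have hnc : normConst d d ≠ 0 := normConst_diagonal_ne_zero hσ
  have hdne : ∀ k : ℕ, d ≠ -((k : ℂ) + 1) := by
    intro k h
    have h1 := congrArg Complex.re h
    have h2 : (0 : ℝ) ≤ k := Nat.cast_nonneg k
    rw [hd, Complex.ofReal_re] at h1
    simp at h1
    linarith
  have hre : -1 < d.re + d.re := by rw [hd, Complex.ofReal_re]; linarith
  have h := (tendsto_integral_convKernel d d hre hdne hdne).norm
  have hpos : 0 < ‖normConst d d‖ := norm_pos_iff.2 hnc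
  refine ⟨2 / ‖normConst d d‖, ?_⟩
  have h2 : ‖(1 : ℂ)‖ < 2 := by simp
  filter_upwards [h.eventually_lt_const h2, self_mem_nhdsWithin] with r hr hr01
  simp only [hd, convKernel_diagonal σ hr01] at hr
  rw [integral_const_mul, norm_mul, integral_complex_ofReal, Complex.norm_real] at hr
  rw [le_div_iff₀ hpos, mul_comm]
  refine le_trans ?_ hr.le
  exact mul_le_mul_of_nonneg_left (Real.le_norm_self _) (norm_nonneg _)

/-- The kernels are bounded in `L¹`. -/
lemma exists_eventually_integral_norm_convKernel_le (a b : ℂ) (hre : -1 < a.re + b.re) :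
    ∃ K, ∀ᶠ r in 𝓝[Set.Ico (0 : ℝ) 1] 1, ∫ w, ‖convKernel a b r w‖ ∂haarCircle ≤ K := by
  obtain ⟨C, hC0, hC⟩ := exists_norm_convKernel_le a b
  have hσ : 0 < a.re + b.re + 1 := by linarith
  obtain ⟨K, hK⟩ := exists_eventually_integral_rpow_le hσ
  refine ⟨C * K, ?_⟩
  filter_upwards [hK, self_mem_nhdsWithin] with r hr hr01
  have he : a.re + b.re + 1 + 1 = a.re + b.re + 2 := by ring
  rw [he] at hr
  refine le_trans (integral_mono (integrable_circle_real (continuous_convKernel a b hr01).norm)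
    ?_ (hC r hr01)) ?_
  · exact integrable_circle_real (continuous_const.mul (continuous_const.mul
      (continuous_norm_rpow _ hr01)))
  · rw [integral_const_mul]
    exact mul_le_mul_of_nonneg_left hr hC0

lemma circle_dist_eq (w v : Circle) : dist w v = ‖(w : ℂ) - (v : ℂ)‖ := by
  rw [← dist_eq_norm]; rfl

/-- By the triangle inequality `|w - 1| ≤ |1 - rw| + (1 - r)`, and `1 - r ≤ |1 - rw|`. -/
lemma half_dist_le {r : ℝ} (hr : r ∈ Set.Ico (0 : ℝ) 1) (w : Circle) :
    dist w 1 / 2 ≤ ‖1 - (r : ℂ) * (w : ℂ)‖ := by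
  have h1 : 1 - r ≤ ‖1 - (r : ℂ) * (w : ℂ)‖ := by
    have := norm_sub_norm_le (1 : ℂ) ((r : ℂ) * (w : ℂ))
    rwa [norm_one, norm_mul, Circle.norm_coe, mul_one, Complex.norm_real,
      Real.norm_of_nonneg hr.1] at this
  have h2 : dist w 1 ≤ ‖1 - (r : ℂ) * (w : ℂ)‖ + (1 - r) := by
    rw [circle_dist_eq, Circle.coe_one, ← norm_neg]
    have e : -((w : ℂ) - 1) = (1 - (r : ℂ) * (w : ℂ)) - ((1 - r : ℝ) : ℂ) * (w : ℂ) := by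
      push_cast; ring
    rw [e]
    refine (norm_sub_le _ _).trans ?_
    rw [norm_mul, Circle.norm_coe, mul_one, Complex.norm_real,
      Real.norm_of_nonneg (by linarith [hr.2])]
  linarith

/-- The kernels concentrate at `1`. -/
lemma tendsto_integral_convKernel_away (a b : ℂ) (hre : -1 < a.re + b.re) {δ : ℝ} (hδ : 0 < δ) :
    Tendsto (fun r => ∫ w in {w : Circle | δ ≤ dist w 1}, ‖convKernel a b r w‖ ∂haarCircle)
      (𝓝[Set.Ico 0 1] 1) (𝓝 0) := by
  obtain ⟨C, hC0, hC⟩ := exists_norm_convKernel_le a b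
  have hσ : 0 < a.re + b.re + 1 := by linarith
  have hlim : Tendsto (fun r : ℝ => C * ((1 - r ^ 2) ^ (a.re + b.re + 1) *
      (δ / 2) ^ (-(a.re + b.re + 2)))) (𝓝[Set.Ico 0 1] 1) (𝓝 0) := by
    have := (((tendsto_one_sub_rpow hσ).comp tendsto_sq_Ico).mul_const
      ((δ / 2) ^ (-(a.re + b.re + 2)))).const_mul C
    simpa only [zero_mul, mul_zero, Function.comp_def] using this
  refine squeeze_zero' (.of_forall fun r => integral_nonneg fun w => norm_nonneg _) ?_ hlim
  filter_upwards [self_mem_nhdsWithin] with r hr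
  have hr2 : 0 ≤ 1 - r ^ 2 := by have := hr.1; have := hr.2; nlinarith
  set A := {w : Circle | δ ≤ dist w 1} with hA
  have hAm : MeasurableSet A :=
    (isClosed_le continuous_const (continuous_id.dist continuous_const)).measurableSet
  set B := C * ((1 - r ^ 2) ^ (a.re + b.re + 1) * (δ / 2) ^ (-(a.re + b.re + 2))) with hB
  have hB0 : 0 ≤ B := by
    have := Real.rpow_nonneg hr2 (a.re + b.re + 1); positivity
  have hbd : ∀ w ∈ A, ‖convKernel a b r w‖ ≤ B := by
    intro w hw
    refine (hC r hr w).trans ?_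
    have hd : δ / 2 ≤ ‖1 - (r : ℂ) * (w : ℂ)‖ :=
      (div_le_div_of_nonneg_right hw two_pos.le).trans (half_dist_le hr w)
    have := Real.rpow_le_rpow_of_nonpos (half_pos hδ) hd
      (show -(a.re + b.re + 2) ≤ 0 by linarith)
    have := Real.rpow_nonneg hr2 (a.re + b.re + 1)
    rw [hB]
    gcongr
  have hle : ∫ w in A, ‖convKernel a b r w‖ ∂haarCircle ≤ ∫ _ in A, B ∂haarCircle :=
    setIntegral_mono_on
      (integrable_circle_real (continuous_convKernel a b hr).norm).integrableOn
      (integrable_const B).integrableOn hAm hbd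
  refine hle.trans ?_
  rw [setIntegral_const, smul_eq_mul]
  exact mul_le_of_le_one_left hB0 measureReal_le_one

/-! ### Product approximate identities on the torus -/

section Torus

variable {n : ℕ}

lemma haarTorus_eq_pi : haarTorus n = Measure.pi fun _ => haarCircle := by
  have h := Measure.haarMeasure_unique (Measure.pi fun _ : Fin n => haarCircle)
    (⊤ : TopologicalSpace.PositiveCompacts (Torus n))
  rw [TopologicalSpace.PositiveCompacts.coe_top, measure_univ, one_smul] at h
  exact h.symm

instance : IsProbabilityMeasure (haarTorus n) := by
  rw [haarTorus_eq_pi]; infer_instance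

instance : (haarTorus n).IsHaarMeasure := by unfold haarTorus; infer_instance

lemma integrable_torus_of_continuous {E : Type*} [NormedAddCommGroup E] {f : Torus n → E}
    (hf : Continuous f) : Integrable f (haarTorus n) :=
  hf.integrable_of_hasCompactSupport (HasCompactSupport.of_compactSpace _)

lemma integral_torus_prod {𝕜 : Type*} [RCLike 𝕜] (k : Fin n → Circle → 𝕜) :
    ∫ ζ, ∏ j, k j (ζ j) ∂haarTorus n = ∏ j, ∫ w, k j w ∂haarCircle := by
  rw [haarTorus_eq_pi, integral_fintype_prod_eq_prod]

/-- Either all coordinates lie within `δ` of `1`, where `ψ` is at most `ε`, or some coordinate `i`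
does not; a union bound over `i` covers the second case. -/
lemma norm_integral_torus_le {k : Fin n → Circle → ℂ} (hk : ∀ j, Continuous (k j))
    {ψ : Torus n → ℂ} {ε M δ : ℝ}
    (hψM : ∀ ζ, ‖ψ ζ‖ ≤ M) (hψδ : ∀ ζ, (∀ j, dist (ζ j) 1 < δ) → ‖ψ ζ‖ ≤ ε) (hε : 0 ≤ ε) :
    ‖∫ ζ, ψ ζ * ∏ j, k j (ζ j) ∂haarTorus n‖ ≤
      ε * ∏ j, ∫ w, ‖k j w‖ ∂haarCircle +
      M * ∑ i, (∫ w in {w : Circle | δ ≤ dist w 1}, ‖k i w‖ ∂haarCircle) *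
        ∏ j ∈ Finset.univ.erase i, ∫ w, ‖k j w‖ ∂haarCircle := by
  classical
  set A := {w : Circle | δ ≤ dist w 1} with hA
  have hAm : MeasurableSet A :=
    (isClosed_le continuous_const (continuous_id.dist continuous_const)).measurableSet
  have hM : 0 ≤ M := (norm_nonneg _).trans (hψM 1)
  -- Only factor `i` is cut off to `A`, so the product form survives and the integral still factors.
  set g : Fin n → Fin n → Circle → ℝ := fun i j w =>
    if j = i then A.indicator (fun w => ‖k j w‖) w else ‖k j w‖ with hg
  have hgi : ∀ i j, Integrable (g i j) haarCircle := by
    intro i j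
    by_cases h : j = i
    · simp only [hg, h, if_true]
      exact (integrable_circle_real (hk i).norm).indicator hAm
    · simp only [hg, h, if_false]
      exact integrable_circle_real (hk j).norm
  have hgprod : ∀ i, Integrable (fun ζ : Torus n => ∏ j, g i j (ζ j)) (haarTorus n) := by
    intro i
    rw [haarTorus_eq_pi]
    exact Integrable.fintype_prod (hgi i)
  have hg0 : ∀ i j w, 0 ≤ g i j w := by
    intro i j w
    simp only [hg]
    split_ifs
    · exact Set.indicator_nonneg (fun _ _ => norm_nonneg _) _
    · exact norm_nonneg _
  have hcont : Continuous fun ζ : Torus n => ∏ j, ‖k j (ζ j)‖ :=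
    continuous_finsetProd _ fun j _ => ((hk j).comp (continuous_apply j)).norm
  have hpt : ∀ ζ : Torus n, ‖ψ ζ * ∏ j, k j (ζ j)‖ ≤
      ε * ∏ j, ‖k j (ζ j)‖ + M * ∑ i, ∏ j, g i j (ζ j) := by
    intro ζ
    rw [norm_mul, norm_prod]
    have hp : 0 ≤ ∏ j, ‖k j (ζ j)‖ := Finset.prod_nonneg fun _ _ => norm_nonneg _
    have hs : ∀ i ∈ Finset.univ, 0 ≤ ∏ j, g i j (ζ j) := fun i _ =>
      Finset.prod_nonneg fun j _ => hg0 i j _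
    by_cases h : ∀ j, dist (ζ j) 1 < δ
    · have := mul_le_mul_of_nonneg_right (hψδ ζ h) hp
      have := mul_nonneg hM (Finset.sum_nonneg hs)
      linarith
    · push Not at h
      obtain ⟨i, hi⟩ := h
      have he : ∏ j, g i j (ζ j) = ∏ j, ‖k j (ζ j)‖ := by
        refine Finset.prod_congr rfl fun j _ => ?_
        simp only [hg]
        split_ifs with hji
        · subst hji; exact Set.indicator_of_mem (s := A) hi _
        · rfl
      have h1 := Finset.single_le_sum hs (Finset.mem_univ i)
      rw [he] at h1
      have h2 := mul_le_mul_of_nonneg_right (hψM ζ) hp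
      have h3 := mul_le_mul_of_nonneg_left h1 hM
      have h4 := mul_nonneg hε hp
      linarith
  refine (norm_integral_le_of_norm_le ?_ (.of_forall hpt)).trans (le_of_eq ?_)
  · exact ((integrable_torus_of_continuous hcont).const_mul ε).add
      ((integrable_finsetSum _ fun i _ => hgprod i).const_mul M)
  · rw [integral_add ((integrable_torus_of_continuous hcont).const_mul ε)
      ((integrable_finsetSum _ fun i _ => hgprod i).const_mul M), integral_const_mul,
      integral_const_mul, integral_finsetSum _ fun i _ => hgprod i,
      integral_torus_prod fun j w => ‖k j w‖]
    congr 2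
    refine Finset.sum_congr rfl fun i _ => ?_
    rw [integral_torus_prod (g i), ← Finset.mul_prod_erase _ _ (Finset.mem_univ i)]
    congr 1
    · simp only [hg, if_true]
      rw [integral_indicator hAm]
    · refine Finset.prod_congr rfl fun j hj => ?_
      simp only [hg, Finset.ne_of_mem_erase hj, if_false]

/-- Products of one-variable approximate identities are approximate identities on the torus. -/
lemma tendsto_integral_mul_prod {ι : Type*} {l : Filter ι} {k : ι → Fin n → Circle → ℂ}
    (hk : ∀ᶠ i in l, ∀ j, Continuous (k i j))
    (hmass : ∀ j, Tendsto (fun i => ∫ w, k i j w ∂haarCircle) l (𝓝 1))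
    {K : Fin n → ℝ} (hK : ∀ j, ∀ᶠ i in l, ∫ w, ‖k i j w‖ ∂haarCircle ≤ K j)
    (haway : ∀ j, ∀ δ > 0, Tendsto
      (fun i => ∫ w in {w : Circle | δ ≤ dist w 1}, ‖k i j w‖ ∂haarCircle) l (𝓝 0))
    {ψ : Torus n → ℂ} (hψ : Continuous ψ) :
    Tendsto (fun i => ∫ ζ, ψ ζ * ∏ j, k i j (ζ j) ∂haarTorus n) l (𝓝 (ψ 1)) := by
  -- Nonnegativity of `K j` is read off at some index where the bound holds, which requires a
  -- nontrivial filter.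
  rcases l.eq_or_neBot with rfl | hl
  · exact tendsto_bot
  have hI0 : ∀ i j, 0 ≤ ∫ w, ‖k i j w‖ ∂haarCircle := fun i j =>
    integral_nonneg fun _ => norm_nonneg _
  have hK0 : ∀ j, 0 ≤ K j := fun j => by
    obtain ⟨i, hi⟩ := (hK j).exists
    exact (hI0 i j).trans hi
  have hmain : Tendsto (fun i => ψ 1 * ∏ j, ∫ w, k i j w ∂haarCircle) l (𝓝 (ψ 1)) := by
    have := (tendsto_finsetProd Finset.univ fun j _ => hmass j).const_mul (ψ 1)
    simpa only [Finset.prod_const_one, mul_one] using this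
  have hdiff : Tendsto (fun i => ∫ ζ, (ψ ζ - ψ 1) * ∏ j, k i j (ζ j) ∂haarTorus n) l (𝓝 0) := by
    rw [Metric.tendsto_nhds]
    intro ε hε
    obtain ⟨M, hM⟩ : ∃ M, ∀ ζ, ‖ψ ζ - ψ 1‖ ≤ M := by
      obtain ⟨M, hM⟩ := isCompact_univ.exists_bound_of_continuousOn
        (hψ.sub continuous_const : Continuous fun ζ => ψ ζ - ψ 1).continuousOn
      exact ⟨M, fun ζ => hM ζ trivial⟩
    set P := ∏ j, K j with hP
    have hP0 : 0 ≤ P := Finset.prod_nonneg fun j _ => hK0 j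
    -- `P` may vanish; the `+ 1` keeps the quotient meaningful and still gives `η * P ≤ ε / 2`.
    set η := ε / (2 * (P + 1)) with hη
    have hη0 : 0 < η := by positivity
    obtain ⟨δ, hδ, hδψ⟩ := Metric.continuousAt_iff.1 (hψ.continuousAt (x := 1)) η hη0
    have hsmall : Tendsto (fun i => M * ∑ j, (∫ w in {w : Circle | δ ≤ dist w 1}, ‖k i j w‖
        ∂haarCircle) * ∏ m ∈ Finset.univ.erase j, K m) l (𝓝 0) := by
      have := (tendsto_finsetSum Finset.univ fun j _ =>
        (haway j δ hδ).mul_const (∏ m ∈ Finset.univ.erase j, K m)).const_mul M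
      simpa only [zero_mul, Finset.sum_const_zero, mul_zero] using this
    filter_upwards [hk, eventually_all.2 hK, hsmall.eventually_lt_const (half_pos hε)]
      with i hki hKi hsi
    rw [dist_zero_right]
    have hM0 : 0 ≤ M := (norm_nonneg _).trans (hM 1)
    have hb := norm_integral_torus_le hki (ψ := fun ζ => ψ ζ - ψ 1) hM (δ := δ) (ε := η)
      (fun ζ hζ => by
        have := hδψ ((dist_pi_lt_iff hδ).2 hζ)
        rw [dist_eq_norm] at this
        exact this.le) hη0.le
    refine lt_of_le_of_lt hb ?_
    have h1 : ∏ j, ∫ w, ‖k i j w‖ ∂haarCircle ≤ P :=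
      Finset.prod_le_prod (fun j _ => hI0 i j) fun j _ => hKi j
    have h2 : M * ∑ j, (∫ w in {w : Circle | δ ≤ dist w 1}, ‖k i j w‖ ∂haarCircle) *
          ∏ m ∈ Finset.univ.erase j, ∫ w, ‖k i m w‖ ∂haarCircle ≤
        M * ∑ j, (∫ w in {w : Circle | δ ≤ dist w 1}, ‖k i j w‖ ∂haarCircle) *
          ∏ m ∈ Finset.univ.erase j, K m := by
      refine mul_le_mul_of_nonneg_left (Finset.sum_le_sum fun j _ => ?_) hM0
      exact mul_le_mul_of_nonneg_left (Finset.prod_le_prod (fun m _ => hI0 i m) fun m _ => hKi m)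
        (integral_nonneg fun _ => norm_nonneg _)
    have h3 : η * ∏ j, ∫ w, ‖k i j w‖ ∂haarCircle ≤ η * P :=
      mul_le_mul_of_nonneg_left h1 hη0.le
    have h4 : η * P ≤ ε / 2 := by
      rw [hη, div_mul_eq_mul_div, div_le_div_iff₀ (by positivity) two_pos]
      nlinarith
    linarith
  have hadd := hdiff.add hmain
  rw [zero_add] at hadd
  refine hadd.congr' ?_
  filter_upwards [hk] with i hki
  have hprod : Continuous fun ζ : Torus n => ∏ j, k i j (ζ j) :=
    continuous_finsetProd _ fun j _ => (hki j).comp (continuous_apply j)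
  have hsub : Continuous fun ζ : Torus n => (ψ ζ - ψ 1) * ∏ j, k i j (ζ j) :=
    (hψ.sub continuous_const).mul hprod
  have hconst : Continuous fun ζ : Torus n => ψ 1 * ∏ j, k i j (ζ j) :=
    continuous_const.mul hprod
  rw [← integral_torus_prod, ← integral_const_mul,
    ← integral_add (integrable_torus_of_continuous hsub) (integrable_torus_of_continuous hconst)]
  refine integral_congr_ae (.of_forall fun ζ => ?_)
  simp only
  ring

end Torus

/-! ### Convolution of the kernel with a measure -/

section Torus

variable {n : ℕ}

lemma exists_bound_torus {f : Torus n → ℂ} (hf : Continuous f) : ∃ C, ∀ ζ, ‖f ζ‖ ≤ C := by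
  obtain ⟨M, hM⟩ := isCompact_univ.exists_bound_of_continuousOn hf.continuousOn
  exact ⟨M, fun ζ => hM ζ trivial⟩

lemma integrable_convolution {ν : Measure (Torus n)} [IsFiniteMeasure ν] {f : Torus n → ℂ}
    (hf : Integrable f ν) {φ K : Torus n → ℂ} (hφ : Continuous φ) (hK : Continuous K) :
    Integrable (fun p : Torus n × Torus n => φ p.1 * (K (p.1 * p.2⁻¹) * f p.2))
      ((haarTorus n).prod ν) := by
  obtain ⟨C, hC⟩ := exists_bound_torus hφ
  obtain ⟨D, hD⟩ := exists_bound_torus hK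
  have hcont : Continuous fun p : Torus n × Torus n => φ p.1 * K (p.1 * p.2⁻¹) :=
    (hφ.comp continuous_fst).mul (hK.comp (continuous_fst.mul continuous_snd.inv))
  have h := (hf.comp_snd (haarTorus n)).bdd_mul (c := C * D) hcont.aestronglyMeasurable
    (.of_forall fun p => by
      rw [norm_mul]
      exact mul_le_mul (hC _) (hD _) (norm_nonneg _) ((norm_nonneg _).trans (hC p.1)))
  simpa only [mul_assoc] using h

lemma integral_convolution {ν : Measure (Torus n)} [IsFiniteMeasure ν] {f : Torus n → ℂ}
    (hf : Integrable f ν) {φ K : Torus n → ℂ} (hφ : Continuous φ) (hK : Continuous K) :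
    ∫ ζ, φ ζ * ∫ η, K (ζ * η⁻¹) * f η ∂ν ∂haarTorus n =
      ∫ η, (∫ ζ, φ (ζ * η) * K ζ ∂haarTorus n) * f η ∂ν := by
  simp only [← integral_const_mul]
  rw [integral_integral_swap (integrable_convolution hf hφ hK)]
  refine integral_congr_ae (.of_forall fun η => ?_)
  simp only [← mul_assoc]
  -- Translating `ζ` by `η` transfers the shift from the kernel to `φ`.
  rw [integral_mul_const, ← integral_mul_right_eq_self (fun ζ => φ ζ * K (ζ * η⁻¹)) η]
  simp only [mul_inv_cancel_right]

/-- The kernel of the dilate by `r`, as a convolution kernel on the torus. -/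
def torusKernel (α β : Fin n → ℂ) (r : Fin n → ℝ) (ζ : Torus n) : ℂ :=
  ∏ j, convKernel (α j) (β j) (r j) (ζ j)

lemma kernel_eq_torusKernel (α β : Fin n → ℂ) (r : Fin n → ℝ) (ζ η : Torus n) :
    kernel α β (fun j => (r j : ℂ) * (ζ j : ℂ)) η = torusKernel α β r (ζ * η⁻¹) :=
  Finset.prod_congr rfl fun _ _ => kernelOne_eq_convKernel _ _ _ _ _

lemma continuous_torusKernel (α β : Fin n → ℂ) {r : Fin n → ℝ} (hr : r ∈ cube n) :
    Continuous (torusKernel α β r) :=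
  continuous_finsetProd _ fun j _ => (continuous_convKernel _ _ (hr j)).comp (continuous_apply j)

lemma tendsto_apply_cube (j : Fin n) :
    Tendsto (fun r : Fin n → ℝ => r j) (𝓝[cube n] 1) (𝓝[Set.Ico 0 1] 1) := by
  refine tendsto_nhdsWithin_iff.2 ⟨?_, ?_⟩
  · exact ((continuous_apply j).tendsto (1 : Fin n → ℝ)).mono_left nhdsWithin_le_nhds
  · filter_upwards [self_mem_nhdsWithin] with r hr
    exact hr j

lemma dilate_eq_integral {α β : Fin n → ℂ} {ν : Measure (Torus n)} {f : Torus n → ℂ}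
    (hf : Integrable f ν) {u : (Fin n → ℂ) → ℂ}
    (hu : ∀ z : Fin n → ℂ, (∀ j, ‖z j‖ < 1) → u z = poissonIntegral α β (ν.withDensityᵥ f) z)
    {r : Fin n → ℝ} (hr : r ∈ cube n) (ζ : Torus n) :
    dilate u r ζ = ∫ η, torusKernel α β r (ζ * η⁻¹) * f η ∂ν := by
  have hcont : Continuous fun η => torusKernel α β r (ζ * η⁻¹) :=
    (continuous_torusKernel α β hr).comp (continuous_const.mul continuous_inv)
  obtain ⟨C, hC⟩ := exists_bound_torus hcont
  rw [dilate, hu _ fun j => norm_mul_circle_lt (hr j) (ζ j), poissonIntegral]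
  simp only [kernel_eq_torusKernel]
  exact pairing_withDensityᵥ hf hcont.stronglyMeasurable hC

/-- Dominated convergence in `η`: the inner integral tests the approximate identity on `ζ ↦ φ (ζ *
η)`, whose value at `1` is `φ η`, and is eventually at most `C * ∏ j, K j` uniformly in `η`. -/
lemma tendsto_integral_convolution {α β : Fin n → ℂ}
    (hre : ∀ j, -1 < (α j).re + (β j).re)
    (hα : ∀ j, ∀ k : ℕ, α j ≠ -((k : ℂ) + 1))
    (hβ : ∀ j, ∀ k : ℕ, β j ≠ -((k : ℂ) + 1))
    {ν : Measure (Torus n)} [IsFiniteMeasure ν] {f : Torus n → ℂ} (hf : Integrable f ν)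
    {φ : Torus n → ℂ} (hφ : Continuous φ) :
    Tendsto (fun r => ∫ η, (∫ ζ, φ (ζ * η) * torusKernel α β r ζ ∂haarTorus n) * f η ∂ν)
      (𝓝[cube n] 1) (𝓝 (∫ η, φ η * f η ∂ν)) := by
  choose K hK using fun j => exists_eventually_integral_norm_convKernel_le (α j) (β j) (hre j)
  have hK' : ∀ j, ∀ᶠ r in 𝓝[cube n] (1 : Fin n → ℝ),
      ∫ w, ‖convKernel (α j) (β j) (r j) w‖ ∂haarCircle ≤ K j := fun j =>
    (tendsto_apply_cube j).eventually (hK j)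
  obtain ⟨C, hC⟩ := exists_bound_torus hφ
  have hC0 : 0 ≤ C := (norm_nonneg _).trans (hC 1)
  refine tendsto_integral_filter_of_dominated_convergence (fun η => C * (∏ j, K j) * ‖f η‖)
    ?_ ?_ (hf.norm.const_mul _) (.of_forall fun η => ?_)
  · filter_upwards [self_mem_nhdsWithin] with r hr
    have hcont : Continuous fun p : Torus n × Torus n => φ (p.2 * p.1) * torusKernel α β r p.2 :=
      (hφ.comp (continuous_snd.mul continuous_fst)).mul
        ((continuous_torusKernel α β hr).comp continuous_snd)
    exact (hcont.stronglyMeasurable.integral_prod_right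
      (ν := haarTorus n)).aestronglyMeasurable.mul hf.1
  · filter_upwards [self_mem_nhdsWithin, eventually_all.2 hK'] with r hr hKr
    refine .of_forall fun η => ?_
    rw [norm_mul]
    refine mul_le_mul_of_nonneg_right ?_ (norm_nonneg _)
    have hint : Integrable (fun ζ => C * ∏ j, ‖convKernel (α j) (β j) (r j) (ζ j)‖)
        (haarTorus n) :=
      integrable_torus_of_continuous (continuous_const.mul (continuous_finsetProd _ fun j _ =>
        ((continuous_convKernel _ _ (hr j)).comp (continuous_apply j)).norm))
    refine (norm_integral_le_of_norm_le hint (.of_forall fun ζ => ?_)).trans ?_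
    · rw [norm_mul, torusKernel, norm_prod]
      exact mul_le_mul_of_nonneg_right (hC _) (Finset.prod_nonneg fun _ _ => norm_nonneg _)
    · rw [integral_const_mul, integral_torus_prod fun j w => ‖convKernel (α j) (β j) (r j) w‖]
      exact mul_le_mul_of_nonneg_left (Finset.prod_le_prod
        (fun j _ => integral_nonneg fun _ => norm_nonneg _) fun j _ => hKr j) hC0
  · have h := tendsto_integral_mul_prod (l := 𝓝[cube n] (1 : Fin n → ℝ))
      (k := fun r j => convKernel (α j) (β j) (r j)) (K := K)
      (by
        filter_upwards [self_mem_nhdsWithin] with r hr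
        exact fun j => continuous_convKernel _ _ (hr j))
      (fun j => (tendsto_integral_convKernel _ _ (hre j) (hα j) (hβ j)).comp
        (tendsto_apply_cube j)) hK'
      (fun j δ hδ => (tendsto_integral_convKernel_away _ _ (hre j) hδ).comp
        (tendsto_apply_cube j))
      (ψ := fun ζ => φ (ζ * η)) (hφ.comp (continuous_id.mul continuous_const))
    rw [one_mul] at h
    exact h.mul_const _

end Torus

end PolydiscPoisson

end

/-! ### The main theorem -/

theorem theorem3p10 (n : ℕ) (α β : Fin n → ℂ)
    (hre : ∀ j, -1 < (α j).re + (β j).re)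
    (hα : ∀ j, ∀ k : ℕ, α j ≠ -((k : ℂ) + 1))
    (hβ : ∀ j, ∀ k : ℕ, β j ≠ -((k : ℂ) + 1))
    (μ : ComplexMeasure (PolydiscPoisson.Torus n))
    (u : (Fin n → ℂ) → ℂ) (hu : ∀ z : Fin n → ℂ, (∀ j, ‖z j‖ < 1) →
      u z = PolydiscPoisson.poissonIntegral α β μ z) :
    (∀ r ∈ PolydiscPoisson.cube n,
      Integrable (PolydiscPoisson.dilate u r) (PolydiscPoisson.haarTorus n)) ∧
    PolydiscPoisson.TendstoWeakStar
      (fun r : Fin n → ℝ =>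
        (PolydiscPoisson.haarTorus n).withDensityᵥ (PolydiscPoisson.dilate u r))
      (𝓝[PolydiscPoisson.cube n] (1 : Fin n → ℝ)) μ := by
  obtain ⟨ν, f, hν, hf, rfl⟩ := PolydiscPoisson.exists_withDensityᵥ_eq μ
  have hdil := fun r hr => funext (PolydiscPoisson.dilate_eq_integral hf hu (r := r) hr)
  have hint : ∀ r ∈ PolydiscPoisson.cube n,
      Integrable (PolydiscPoisson.dilate u r) (PolydiscPoisson.haarTorus n) := by
    intro r hr
    rw [hdil r hr]
    -- With test function `1`, Fubini gives integrability of the dilate from that of the double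
    -- integrand.
    have h := (PolydiscPoisson.integrable_convolution hf (φ := fun _ => 1) continuous_const
      (PolydiscPoisson.continuous_torusKernel α β hr)).integral_prod_left
    simpa only [one_mul] using h
  refine ⟨hint, fun φ => ?_⟩
  obtain ⟨C, hC⟩ := PolydiscPoisson.exists_bound_torus φ.continuous
  rw [PolydiscPoisson.pairing_withDensityᵥ hf φ.continuous.stronglyMeasurable hC]
  refine (PolydiscPoisson.tendsto_integral_convolution hre hα hβ hf φ.continuous).congr' ?_
  filter_upwards [self_mem_nhdsWithin] with r hr
  rw [PolydiscPoisson.pairing_withDensityᵥ (hint r hr) φ.continuous.stronglyMeasurable hC,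
    ← PolydiscPoisson.integral_convolution hf φ.continuous
      (PolydiscPoisson.continuous_torusKernel α β hr), hdil r hr]
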